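/- Let $n\ge 0$ and let $\mathrm{Mat}(n)$ be the set of matroids on $[n]=\{1,\dots,n\}$. For $M\in\mathrm{Mat}(n)$ with rank function $\operatorname{rk}_M$ and rank $\operatorname{rk} M=\operatorname{rk}_M([n])$, let $P(M)\subset\mathbb{R}^n$ be its matroid polytope, the convex hull of the $0/1$ indicator vectors of the bases of $M$. A \emph{matroidal subdivision} of $P(M)$ is a set $\mathcal{D}$ of polytopes, each of the form $P(N)$ with $N\in\mathrm{Mat}(n)$, whose union is $P(M)$, such that every nonempty face of a member of $\mathcal{D}$ is in $\mathcal{D}$ and any two members of $\mathcal{D}$ that meet intersect in a common face. Let $\mathcal{D}_{in}$ be the set of internal members of $\mathcal{D}$, that is, those not contained in any proper face of $P(M)$. A function $f$ from $\mathrm{Mat}(n)$ to an abelian group is \emph{valuative} if for every $M\in\mathrm{Mat}(n)$ and every matroidal subdivision $\mathcal{D}$ of $P(M)$, \[f(M)=\sum_{P(N)\in\mathcal{D}_{in}}(-1)^{\dim P(M)-\dim P(N)}f(N).\] It is a \emph{matroid invariant} if it takes the same value on isomorphic matroids. \textbf{Lemma.} For $M\in\mathrm{Mat}(n)$ define \[s_M(x,y,z)=\sum_{S\subseteq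 T\subseteq[n]}x^{\#S-\operatorname{rk}_M S}\,y^{\operatorname{rk} M-\operatorname{rk}_M T}\,z^{\#T-\#S}\in\mathbb{Z}[x,y,z].\] Then the function $M\mapsto s_M$ is a valuative matroid invariant. -/

import Mathlib

/-- The set of all matroids on the ground set `[n]`, modelled as `Fin n`. -/
def Mat (n : ℕ) : Type := {M : Matroid (Fin n) // M.E = Set.univ}

instance Mat.instFinite (n : ℕ) : Finite (Mat n) := by
  refine Finite.of_injective (fun M : Mat n => {B : Set (Fin n) | M.1.IsBase B}) ?_
  intro M N h
  refine Subtype.ext (Matroid.ext_isBase (M.2.trans N.2.symm) fun B _ => ?_)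
  exact Set.ext_iff.1 h B

noncomputable instance Mat.instFintype (n : ℕ) : Fintype (Mat n) := Fintype.ofFinite _

/-- The matroid on `[n]` obtained from `M` by relabelling the ground set along `σ`. -/
def Mat.relabel {n : ℕ} (M : Mat n) (σ : Equiv.Perm (Fin n)) : Mat n :=
  ⟨M.1.mapEquiv σ, by simp [M.2]⟩

/-- The rank of a subset of `[n]` in `M`, as a natural number. -/
noncomputable def Mat.rk {n : ℕ} (M : Mat n) (S : Finset (Fin n)) : ℕ :=
  (M.1.eRk (S : Set (Fin n))).toNat

/-- The matroid polytope `P(M)`: the convex hull of the 0/1 indicator vectors of the bases. -/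
noncomputable def Mat.polytope {n : ℕ} (M : Mat n) : Set (Fin n → ℝ) :=
  convexHull ℝ ((fun B : Set (Fin n) => B.indicator (fun _ => (1 : ℝ))) '' {B | M.1.IsBase B})

/-- `F` is a (nonempty, possibly improper) face of the polytope `P`: the nonempty set of points of
`P` at which some linear functional attains its maximum over `P`. -/
def IsPolytopeFace {n : ℕ} (P F : Set (Fin n → ℝ)) : Prop :=
  F.Nonempty ∧ IsExposed ℝ P F

/-- The dimension of a convex set, that is, of its affine span. -/
noncomputable def polytopeDim {n : ℕ} (P : Set (Fin n → ℝ)) : ℕ :=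
  Module.finrank ℝ (vectorSpan ℝ P)

/-- `D` is a matroidal subdivision of `P(M)`: a polyhedral complex with union `P(M)`, all of whose
cells (of all dimensions) are matroid polytopes of matroids on `[n]`. -/
structure IsMatroidalSubdivision {n : ℕ} (M : Mat n) (D : Set (Set (Fin n → ℝ))) : Prop where
  matroidal : ∀ P ∈ D, ∃ N : Mat n, N.polytope = P
  face_mem : ∀ P ∈ D, ∀ F, IsPolytopeFace P F → F ∈ D
  inter_face : ∀ P ∈ D, ∀ Q ∈ D, (P ∩ Q).Nonempty →
    IsPolytopeFace P (P ∩ Q) ∧ IsPolytopeFace Q (P ∩ Q)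
  union_eq : ⋃₀ D = M.polytope

/-- The internal cells of a subdivision `D` of `P`: those not contained in the boundary of `P`,
that is, not contained in any proper face of `P`. -/
def internalCells {n : ℕ} (P : Set (Fin n → ℝ)) (D : Set (Set (Fin n → ℝ))) :
    Set (Set (Fin n → ℝ)) :=
  {F ∈ D | ∀ G, IsPolytopeFace P G → F ⊆ G → G = P}

open scoped Classical in
/-- A function from matroids on `[n]` to an abelian group is valuative if its value at `M` is the
alternating sum of its values over the internal cells of every matroidal subdivision of `P(M)`.
The subtraction of dimensions is never truncated, since every cell is contained in `P(M)`; and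
a matroid on `[n]` is determined by its polytope, so each internal cell contributes one term. -/
def IsValuative {n : ℕ} {A : Type*} [AddCommGroup A] (f : Mat n → A) : Prop :=
  ∀ (M : Mat n) (D : Set (Set (Fin n → ℝ))), IsMatroidalSubdivision M D →
    f M = ∑ N : Mat n with N.polytope ∈ internalCells M.polytope D,
      (-1 : ℤ) ^ (polytopeDim M.polytope - polytopeDim N.polytope) • f N

/-- A function on matroids on `[n]` is a matroid invariant if isomorphic matroids have the same
value. -/
def IsMatroidInvariant {n : ℕ} {A : Type*} (f : Mat n → A) : Prop :=
  ∀ (M : Mat n) (σ : Equiv.Perm (Fin n)), f (M.relabel σ) = f M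

/-- `s_M(x,y,z) = ∑_{S ⊆ T ⊆ [n]} x^(#S - rk S) y^(rk M - rk T) z^(#T - #S)`, a polynomial with
integer coefficients in `x = X 0`, `y = X 1`, `z = X 2`. No subtraction of exponents is
truncated. -/
noncomputable def Mat.tutteLike {n : ℕ} (M : Mat n) : MvPolynomial (Fin 3) ℤ :=
  ∑ T : Finset (Fin n), ∑ S ∈ T.powerset,
    MvPolynomial.X 0 ^ (S.card - M.rk S) *
      MvPolynomial.X 1 ^ (M.rk Finset.univ - M.rk T) *
      MvPolynomial.X 2 ^ (T.card - S.card)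

/-! Invariance is a reindexing of the double sum. For valuativity, fix `S ⊆ T`; it suffices that
every function of the pair of ranks of `S` and `T` is valuative, since all cells of a subdivision
have the rank of `M`. By greedy extension of bases, the functional `flagWeight S T` has maximum `(n
+ 1) * rk S + rk T` on a matroid polytope, and this number determines both ranks. So it is enough
that meeting an open half-space is valuative (`sum_meets_halfspace`); differences over consecutive
thresholds then isolate each value of the maximum.

The half-space statement is additivity of the compactly supported Euler characteristic, `(-1) ^ dim`
on nonempty relatively open convex sets. The relative interior of `P(M)` is the disjoint union of
those of the internal cells (`sum_indicator_relInt`), and cutting by an open half-space either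
empties such a piece or preserves its dimension. Additivity (`sum_openEuler_eq_zero`) is proved by
sweeping hyperplanes, one coordinate at a time. -/

/-- The relative interior of a convex set, described algebraically: the points of `F` from which
every segment towards a point of `F` can be prolonged backwards inside `F`. -/
def relInt {E : Type*} [AddCommGroup E] [Module ℝ E] (F : Set E) : Set E :=
  {x ∈ F | ∀ y ∈ F, ∃ ε : ℝ, 0 < ε ∧ x + ε • (x - y) ∈ F}

/-! ### Algebra of relative interiors -/

section RelInt

variable {E : Type*} [AddCommGroup E] [Module ℝ E] {F U : Set E} {x y : E}

theorem relInt_subset (F : Set E) : relInt F ⊆ F := fun _ h => h.1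

theorem lineMap_mem_relInt (hF : Convex ℝ F) (hx : x ∈ relInt F) (hy : y ∈ F) {t : ℝ}
    (ht0 : 0 ≤ t) (ht1 : t < 1) : x + t • (y - x) ∈ relInt F := by
  have hmem : ∀ a b : ℝ, ∀ u ∈ F, ∀ v ∈ F, 0 ≤ a → 0 ≤ b → a + b = 1 → a • u + b • v ∈ F :=
    fun a b u hu v hv ha hb hab => hF hu hv ha hb hab
  refine ⟨?_, fun w hw => ?_⟩
  · have := hmem (1 - t) t x hx.1 y hy (by linarith) ht0 (by ring)
    convert this using 1
    module
  · obtain ⟨ε, hε, hxw⟩ := hx.2 w hw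
    have hd : 0 < 1 + t * ε := by positivity
    have h1t : 0 < 1 - t := by linarith
    -- This length puts the prolonged point on the segment from `x + ε • (x - w)` to `y`.
    refine ⟨(1 - t) * ε / (1 + t * ε), by positivity, ?_⟩
    have := hmem ((1 - t) / (1 + t * ε)) ((1 + (1 - t) * ε / (1 + t * ε)) * t) _ hxw y hy
      (by positivity) (by positivity) (by field_simp; ring)
    convert this using 1
    have h1 : (1 - t) / (1 + t * ε) * (1 + ε) = (1 + (1 - t) * ε / (1 + t * ε)) * (1 - t) := by
      field_simp; ring
    have h2 : (1 - t) / (1 + t * ε) * ε = (1 - t) * ε / (1 + t * ε) := by ring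
    have h3 : ((1 - t) / (1 + t * ε)) • (x + ε • (x - w)) =
      ((1 - t) / (1 + t * ε) * (1 + ε)) • x - ((1 - t) / (1 + t * ε) * ε) • w := by module
    rw [h3, h1, h2]
    module

theorem convex_relInt (hF : Convex ℝ F) : Convex ℝ (relInt F) := by
  rw [convex_iff_forall_pos]
  intro x hx y hy a b ha hb hab
  have := lineMap_mem_relInt hF hx hy.1 hb.le (by linarith)
  convert this using 1
  obtain rfl : a = 1 - b := by linarith
  module

theorem subset_relInt_relInt (hF : Convex ℝ F) : relInt F ⊆ relInt (relInt F) := by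
  refine fun x hx => ⟨hx, fun y hy => ?_⟩
  obtain ⟨ε, hε, h⟩ := hx.2 y hy.1
  refine ⟨ε / 2, by positivity, ?_⟩
  have := lineMap_mem_relInt hF hx h (t := 1 / 2) (by norm_num) (by norm_num)
  convert this using 1
  module

theorem exists_pos_forall_relOpen (hU : U ⊆ relInt U) (hc : Convex ℝ U) (hx : x ∈ U) (hy : y ∈ U) :
    ∃ ε : ℝ, 0 < ε ∧ ∀ δ, 0 ≤ δ → δ ≤ ε → x + δ • (x - y) ∈ U := by
  obtain ⟨ε, hε, h⟩ := (hU hx).2 y hy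
  refine ⟨ε, hε, fun δ h0 h1 => ?_⟩
  have := hc hx h (a := 1 - δ / ε) (b := δ / ε)
    (by rw [sub_nonneg]; exact (div_le_one hε).2 h1) (by positivity) (by ring)
  convert this using 1
  have : δ = δ / ε * ε := by field_simp
  conv_lhs => rw [this]
  module

/-- In a relatively open convex set one can move a little in every direction of its span. -/
theorem exists_pos_add_smul_mem_of_mem_vectorSpan (hU : U ⊆ relInt U) (hc : Convex ℝ U)
    (hx : x ∈ U) {v : E} (hv : v ∈ vectorSpan ℝ U) : ∃ ε : ℝ, 0 < ε ∧ x + ε • v ∈ U := by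
  have shrink : ∀ v : E, ∀ ε : ℝ, 0 < ε → x + ε • v ∈ U → ∀ δ, 0 ≤ δ → δ ≤ ε → x + δ • v ∈ U := by
    intro v ε hε h δ h0 h1
    have := hc hx h (a := 1 - δ / ε) (b := δ / ε)
      (by rw [sub_nonneg]; exact (div_le_one hε).2 h1) (by positivity) (by ring)
    convert this using 1
    have : δ = δ / ε * ε := by field_simp
    conv_lhs => rw [this]
    module
  rw [vectorSpan_eq_span_vsub_set_right ℝ hx] at hv
  induction hv using Submodule.span_induction with
  | mem v hv =>
    obtain ⟨y, hy, rfl⟩ := hv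
    exact ⟨1, one_pos, by simpa using hy⟩
  | zero => exact ⟨1, one_pos, by simpa using hx⟩
  | add v w _ _ hv hw =>
    obtain ⟨ε, hε, h⟩ := hv
    obtain ⟨δ, hδ, h'⟩ := hw
    have h1 := shrink v ε hε h (min ε δ) (by positivity) (min_le_left _ _)
    have h2 := shrink w δ hδ h' (min ε δ) (by positivity) (min_le_right _ _)
    refine ⟨min ε δ / 2, by positivity, ?_⟩
    have := hc h1 h2 (a := 1 / 2) (b := 1 / 2) (by norm_num) (by norm_num) (by norm_num)
    convert this using 1
    module
  | smul a v _ hv =>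
    obtain ⟨ε, hε, h⟩ := hv
    -- For negative `a`, prolong backwards through `x` the segment ending at `x + ε • v`.
    rcases lt_trichotomy a 0 with ha | rfl | ha
    · obtain ⟨δ, hδ, h'⟩ := (hU hx).2 _ h
      refine ⟨δ * ε / (-a), div_pos (by positivity) (by linarith), ?_⟩
      convert h' using 1
      rw [smul_smul, div_mul_eq_mul_div, div_neg, mul_div_assoc, div_self ha.ne]
      module
    · exact ⟨1, one_pos, by simpa using hx⟩
    · refine ⟨ε / a, by positivity, ?_⟩
      rwa [smul_smul, div_mul_cancel₀ _ ha.ne']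

/-- The part of a relatively open convex set in an open half-space is relatively open. -/
theorem halfspace_subset_relInt (hU : U ⊆ relInt U) (hc : Convex ℝ U) (φ : E →ₗ[ℝ] ℝ) (c : ℝ) :
    U ∩ {x | c < φ x} ⊆ relInt (U ∩ {x | c < φ x}) := by
  rintro x ⟨hx, hxt⟩
  refine ⟨⟨hx, hxt⟩, ?_⟩
  rintro y ⟨hy, hyt⟩
  simp only [Set.mem_ofPred_eq] at hxt hyt
  obtain ⟨ε, hε, h⟩ := exists_pos_forall_relOpen hU hc hx hy
  -- A step this short cannot use up the margin `φ x - c`; the `+ 1` covers `φ x = φ y`.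
  have hd : 0 < (φ x - c) / (|φ x - φ y| + 1) := div_pos (by linarith) (by positivity)
  refine ⟨min ε ((φ x - c) / (|φ x - φ y| + 1)), by positivity,
    h _ (by positivity) (min_le_left _ _), ?_⟩
  set δ := min ε ((φ x - c) / (|φ x - φ y| + 1)) with hδ
  have hδ0 : 0 < δ := by positivity
  have h1 : δ * (|φ x - φ y| + 1) ≤ φ x - c := by
    rw [← le_div_iff₀ (by positivity)]; exact min_le_right _ _
  have h2 := neg_abs_le (φ x - φ y)
  simp only [Set.mem_ofPred_eq, map_add, map_smul, map_sub, smul_eq_mul]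
  nlinarith

/-- A half-space that meets a convex set meets its relative interior. -/
theorem relInt_inter_halfspace_nonempty (hF : Convex ℝ F) (hne : (relInt F).Nonempty)
    (φ : E →ₗ[ℝ] ℝ) (c : ℝ) (h : (F ∩ {x | c < φ x}).Nonempty) :
    (relInt F ∩ {x | c < φ x}).Nonempty := by
  obtain ⟨x, hx⟩ := hne
  obtain ⟨y, hy, hyc⟩ := h
  simp only [Set.mem_ofPred_eq] at hyc
  have hd : 0 < (φ y - c) / (|φ y - φ x| + 1) := div_pos (by linarith) (by positivity)
  set δ := min 1 ((φ y - c) / (|φ y - φ x| + 1)) with hδ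
  have hδ0 : 0 < δ := by positivity
  have h1 : δ * (|φ y - φ x| + 1) ≤ φ y - c := by
    rw [← le_div_iff₀ (by positivity)]; exact min_le_right _ _
  have h3 : δ ≤ 1 := min_le_left _ _
  refine ⟨x + (1 - δ) • (y - x), lineMap_mem_relInt hF hx hy (by linarith) (by linarith), ?_⟩
  have h2 := le_abs_self (φ y - φ x)
  simp only [Set.mem_ofPred_eq, map_add, map_smul, map_sub, smul_eq_mul]
  nlinarith

theorem vectorSpan_relInt_inter_halfspace (hF : Convex ℝ F) (φ : E →ₗ[ℝ] ℝ) (c : ℝ)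
    (h : (relInt F ∩ {x | c < φ x}).Nonempty) :
    vectorSpan ℝ (relInt F ∩ {x | c < φ x}) = vectorSpan ℝ F := by
  refine le_antisymm (vectorSpan_mono ℝ (Set.inter_subset_left.trans (relInt_subset F))) ?_
  obtain ⟨x, hx, hxc⟩ := h
  rw [vectorSpan_eq_span_vsub_set_right ℝ (relInt_subset F hx), Submodule.span_le]
  rintro _ ⟨y, hy, rfl⟩
  simp only [Set.mem_ofPred_eq] at hxc
  have hd : 0 < (φ x - c) / (|φ y - φ x| + 1) := div_pos (by linarith) (by positivity)
  set δ := min (1 / 2) ((φ x - c) / (|φ y - φ x| + 1)) with hδ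
  have hδ0 : 0 < δ := by positivity
  have h1 : δ * (|φ y - φ x| + 1) ≤ φ x - c := by
    rw [← le_div_iff₀ (by positivity)]; exact min_le_right _ _
  have h3 : δ ≤ 1 / 2 := min_le_left _ _
  have h2 := neg_abs_le (φ y - φ x)
  have hz : x + δ • (y - x) ∈ relInt F ∩ {x | c < φ x} := by
    refine ⟨lineMap_mem_relInt hF hx hy hδ0.le (by linarith), ?_⟩
    simp only [Set.mem_ofPred_eq, map_add, map_smul, map_sub, smul_eq_mul]
    nlinarith
  have := vsub_mem_vectorSpan ℝ hz (show x ∈ relInt F ∩ {x | c < φ x} from ⟨hx, hxc⟩)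
  rw [vsub_eq_sub, add_sub_cancel_left] at this
  have := (vectorSpan ℝ (relInt F ∩ {x | c < φ x})).smul_mem δ⁻¹ this
  rwa [smul_smul, inv_mul_cancel₀ hδ0.ne', one_smul] at this

/-- A linear functional that attains its maximum over `F` at a relative interior point is constant
on `F`. -/
theorem eq_of_mem_relInt_of_isMax (φ : E →ₗ[ℝ] ℝ) (hx : x ∈ relInt F)
    (hmax : ∀ y ∈ F, φ y ≤ φ x) (hy : y ∈ F) : φ y = φ x := by
  refine le_antisymm (hmax y hy) ?_
  obtain ⟨ε, hε, h⟩ := hx.2 y hy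
  have := hmax _ h
  simp only [map_add, map_smul, map_sub, smul_eq_mul] at this
  nlinarith

theorem vectorSpan_slice (hU : U ⊆ relInt U) (hc : Convex ℝ U) (φ : E →ₗ[ℝ] ℝ) {t : ℝ}
    (h : (U ∩ {x | φ x = t}).Nonempty) :
    vectorSpan ℝ (U ∩ {x | φ x = t}) = vectorSpan ℝ U ⊓ LinearMap.ker φ := by
  obtain ⟨x, hx, hxt⟩ := h
  have hx' : x ∈ U ∩ {x | φ x = t} := ⟨hx, hxt⟩
  apply le_antisymm
  · refine le_inf (vectorSpan_mono ℝ Set.inter_subset_left) ?_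
    rw [vectorSpan_eq_span_vsub_set_right ℝ hx', Submodule.span_le]
    rintro _ ⟨y, ⟨-, hyt⟩, rfl⟩
    simp only [Set.mem_ofPred_eq] at hxt hyt
    simp [hxt, hyt]
  · rintro v ⟨hv, hv0⟩
    obtain ⟨ε, hε, h⟩ := exists_pos_add_smul_mem_of_mem_vectorSpan hU hc hx hv
    have hz : x + ε • v ∈ U ∩ {x | φ x = t} := by
      refine ⟨h, ?_⟩
      simp only [Set.mem_ofPred_eq, SetLike.mem_coe, LinearMap.mem_ker] at hxt hv0 ⊢
      simp [hxt, hv0]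
    have := vsub_mem_vectorSpan ℝ hz hx'
    rw [vsub_eq_sub, add_sub_cancel_left] at this
    have := (vectorSpan ℝ (U ∩ {x | φ x = t})).smul_mem ε⁻¹ this
    rwa [smul_smul, inv_mul_cancel₀ hε.ne', one_smul] at this

theorem finrank_inf_ker_add_one [FiniteDimensional ℝ E] (W : Submodule ℝ E) (φ : E →ₗ[ℝ] ℝ)
    (h : ∃ v ∈ W, φ v ≠ 0) :
    Module.finrank ℝ (W ⊓ LinearMap.ker φ : Submodule ℝ E) + 1 = Module.finrank ℝ W := by
  have h1 := (φ.domRestrict W).finrank_range_add_finrank_ker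
  have h2 : LinearMap.range (φ.domRestrict W) = ⊤ := by
    rw [LinearMap.range_eq_top]
    apply LinearMap.surjective
    intro h0
    obtain ⟨v, hv, hne⟩ := h
    exact hne (by simpa using LinearMap.congr_fun h0 ⟨v, hv⟩)
  have h3 : Module.finrank ℝ (LinearMap.ker (φ.domRestrict W)) =
      Module.finrank ℝ (W ⊓ LinearMap.ker φ : Submodule ℝ E) := by
    have : LinearMap.ker (φ.domRestrict W) = (LinearMap.ker φ).comap W.subtype := by
      ext v; simp
    rw [this, (Submodule.equivMapOfInjective W.subtype W.subtype_injective _).finrank_eq,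
      Submodule.map_comap_subtype]
  rw [h2, finrank_top, Module.finrank_self] at h1
  omega

end RelInt

/-! ### Existence of relative interior points and supporting functionals -/

section Exposed

variable {E : Type*} [NormedAddCommGroup E] [NormedSpace ℝ E] {F : Set E} {x : E}

theorem add_mem_relInt_of_mem_interior {L : Submodule ℝ E} (hL : ∀ y ∈ F, y - x ∈ L) {v : L}
    (hv : v ∈ interior {w : L | x + (w : E) ∈ F}) : x + (v : E) ∈ relInt F := by
  refine ⟨(interior_subset hv : v ∈ {w : L | x + (w : E) ∈ F}), fun y hy => ?_⟩
  let w : L := ⟨y - x, hL y hy⟩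
  have hcont : Continuous fun ε : ℝ => v + ε • (v - w) := by fun_prop
  have hev : ∀ᶠ ε in nhds (0 : ℝ), v + ε • (v - w) ∈ interior {w : L | x + (w : E) ∈ F} := by
    apply hcont.continuousAt.eventually_mem
    simpa using isOpen_interior.mem_nhds hv
  obtain ⟨ε, hε, hpos⟩ :=
    ((hev.filter_mono nhdsWithin_le_nhds).and self_mem_nhdsWithin :
      ∀ᶠ ε in nhdsWithin (0 : ℝ) (Set.Ioi 0), _).exists
  refine ⟨ε, hpos, ?_⟩
  have : x + ((v + ε • (v - w) : L) : E) ∈ F :=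
    (interior_subset hε : v + ε • (v - w) ∈ {w : L | x + (w : E) ∈ F})
  convert this using 1
  simp only [w, Submodule.coe_add, Submodule.coe_smul, Submodule.coe_sub]
  module

variable [FiniteDimensional ℝ E]

/-- Inside the span of `F - x` the translate of `F` is full-dimensional, so topological convexity
results apply to `F` of any dimension. -/
theorem interior_translate_nonempty (hF : Convex ℝ F) (hx : x ∈ F) :
    (interior {w : Submodule.span ℝ ((· - x) '' F) | x + (w : E) ∈ F}).Nonempty ∧
      Convex ℝ {w : Submodule.span ℝ ((· - x) '' F) | x + (w : E) ∈ F} := by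
  set L := Submodule.span ℝ ((· - x) '' F)
  have hA : {w : L | x + (w : E) ∈ F} = Subtype.val ⁻¹' ((· - x) '' F) := by
    ext w
    simp only [Set.mem_ofPred_eq, Set.mem_preimage, Set.mem_image]
    constructor
    · intro h; exact ⟨_, h, by simp⟩
    · rintro ⟨y, hy, h⟩; rw [← h]; simpa using hy
  have hconv : Convex ℝ {w : L | x + (w : E) ∈ F} :=
    (hF.translate_preimage_right x).linear_preimage L.subtype
  refine ⟨?_, hconv⟩
  rw [hconv.interior_nonempty_iff_affineSpan_eq_top,
    AffineSubspace.affineSpan_eq_top_iff_vectorSpan_eq_top_of_nonempty ℝ L L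
      ⟨0, by simpa using hx⟩, hA, eq_top_iff]
  have h0 : (0 : L) ∈ (Subtype.val ⁻¹' ((· - x) '' F) : Set L) := by
    rw [← hA]; simpa using hx
  rw [vectorSpan_eq_span_vsub_set_right ℝ h0]
  simp only [vsub_eq_sub, sub_zero, Set.image_id']
  exact (Submodule.span_span_coe_preimage (R := ℝ) (s := (· - x) '' F)).ge

theorem relInt_nonempty (hF : Convex ℝ F) (hne : F.Nonempty) : (relInt F).Nonempty := by
  obtain ⟨x, hx⟩ := hne
  obtain ⟨v, hv⟩ := (interior_translate_nonempty hF hx).1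
  have hL : ∀ y ∈ F, y - x ∈ Submodule.span ℝ ((· - x) '' F) := fun y hy =>
    Submodule.subset_span ⟨y, hy, rfl⟩
  exact ⟨_, add_mem_relInt_of_mem_interior hL hv⟩

/-- A point of a convex set outside its relative interior lies on a proper supporting
hyperplane. -/
theorem exists_supporting_functional (hF : Convex ℝ F) (hx : x ∈ F) (hx' : x ∉ relInt F) :
    ∃ l : StrongDual ℝ E, (∀ y ∈ F, l y ≤ l x) ∧ ∃ y ∈ F, l y < l x := by
  obtain ⟨hne, hconv⟩ := interior_translate_nonempty hF hx
  set L := Submodule.span ℝ ((· - x) '' F) with hL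
  have hL' : ∀ y ∈ F, y - x ∈ L := fun y hy => Submodule.subset_span ⟨y, hy, rfl⟩
  have h0 : (0 : L) ∉ interior {w : L | x + (w : E) ∈ F} := fun h =>
    hx' (by simpa using add_mem_relInt_of_mem_interior hL' h)
  -- Separation is strict on the interior, which gives the point with `l y < l x`; passing to the
  -- closure gives the weak inequality on all of `F`.
  obtain ⟨f, hf⟩ := geometric_hahn_banach_open_point hconv.interior isOpen_interior h0
  obtain ⟨g, hg⟩ := LinearMap.exists_extend (f : L →ₗ[ℝ] ℝ)
  have hgf : ∀ w : L, g w = f w := fun w => LinearMap.congr_fun hg w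
  refine ⟨LinearMap.toContinuousLinearMap g, fun y hy => ?_, ?_⟩
  · have hmem : (⟨y - x, hL' y hy⟩ : L) ∈ closure (interior {w : L | x + (w : E) ∈ F}) := by
      rw [hconv.closure_interior_eq_closure_of_nonempty_interior hne]
      exact subset_closure (by simpa using hy)
    have hle : closure (interior {w : L | x + (w : E) ∈ F}) ⊆ {w | f w ≤ 0} := by
      refine closure_minimal (fun w hw => ?_) (isClosed_le f.continuous continuous_const)
      simpa using (hf w hw).le
    have h1 : f ⟨y - x, hL' y hy⟩ ≤ 0 := hle hmem
    rw [← hgf] at h1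
    simp only [map_sub] at h1
    simpa using h1
  · obtain ⟨v, hv⟩ := hne
    refine ⟨x + v, (interior_subset hv : v ∈ {w : L | x + (w : E) ∈ F}), ?_⟩
    have := hf v hv
    rw [← hgf, map_zero] at this
    simpa using this

end Exposed

/-! ### Faces and relative interiors -/

section Face

variable {n : ℕ} {P F : Set (Fin n → ℝ)} {x : Fin n → ℝ}

theorem IsPolytopeFace.eq_of_mem_relInt (h : IsPolytopeFace P F) (hxF : x ∈ F)
    (hx : x ∈ relInt P) : F = P := by
  obtain ⟨l, hl⟩ := h.2 h.1
  refine h.2.subset.antisymm fun y hy => ?_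
  rw [hl] at hxF ⊢
  refine ⟨hy, fun z hz => ?_⟩
  have := eq_of_mem_relInt_of_isMax (l : (Fin n → ℝ) →ₗ[ℝ] ℝ) hx hxF.2 hy
  simp only [ContinuousLinearMap.coe_coe] at this
  rw [this]
  exact hxF.2 z hz

/-- The face is cut out by a supporting functional at `x`. On any `F ⊆ P` with `x` in its relative
interior this functional is constant, so the face swallows `F`; hence one relative interior point
decides whether a cell is internal. -/
theorem exists_proper_face_of_notMem_relInt (hP : Convex ℝ P) (hx : x ∈ P) (hx' : x ∉ relInt P) :
    ∃ G, IsPolytopeFace P G ∧ x ∈ G ∧ G ≠ P ∧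
      ∀ F : Set (Fin n → ℝ), F ⊆ P → x ∈ relInt F → F ⊆ G := by
  obtain ⟨l, hl, y, hy, hyx⟩ := exists_supporting_functional hP hx hx'
  have hxG : x ∈ l.toExposed P := ⟨hx, hl⟩
  refine ⟨l.toExposed P, ⟨⟨x, hxG⟩, ContinuousLinearMap.toExposed.isExposed⟩, hxG, ?_, ?_⟩
  · intro h
    rw [← h] at hy
    exact absurd (hy.2 x hx) (not_le.2 hyx)
  · intro F hFP hxF z hz
    have := eq_of_mem_relInt_of_isMax (l : (Fin n → ℝ) →ₗ[ℝ] ℝ) hxF (fun w hw => hl w (hFP hw)) hz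
    simp only [ContinuousLinearMap.coe_coe] at this
    refine ⟨hFP hz, fun w hw => ?_⟩
    rw [this]
    exact hl w hw

end Face

/-! ### Euler characteristic of relatively open convex sets -/

open Classical in
/-- The Euler characteristic with compact supports of a relatively open convex set. -/
noncomputable def openEuler {E : Type*} [AddCommGroup E] [Module ℝ E] (U : Set E) : ℤ :=
  if U.Nonempty then (-1) ^ Module.finrank ℝ (vectorSpan ℝ U) else 0

section Euler

variable {E : Type*} [AddCommGroup E] [Module ℝ E] {U : Set E}

theorem openEuler_of_not_nonempty (h : ¬ U.Nonempty) : openEuler U = 0 := if_neg h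

theorem openEuler_of_nonempty (h : U.Nonempty) :
    openEuler U = (-1) ^ Module.finrank ℝ (vectorSpan ℝ U) := if_pos h

theorem openEuler_singleton (x : E) : openEuler ({x} : Set E) = 1 := by
  rw [openEuler_of_nonempty (Set.singleton_nonempty x), vectorSpan_singleton, finrank_bot, pow_zero]

theorem openEuler_slice_const (φ : E →ₗ[ℝ] ℝ) {τ : ℝ} (hτ : ∀ x ∈ U, φ x = τ) (t : ℝ) :
    openEuler (U ∩ {x | φ x = t}) = if t = τ then openEuler U else 0 := by
  split_ifs with h
  · congr 1
    ext x
    simp only [Set.mem_inter_iff, Set.mem_ofPred_eq, and_iff_left_iff_imp, h]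
    exact hτ x
  · apply openEuler_of_not_nonempty
    rintro ⟨x, hx, hxt⟩
    exact h (hxt.symm.trans (hτ x hx))

theorem openEuler_slice [FiniteDimensional ℝ E] (hU : U ⊆ relInt U) (hc : Convex ℝ U)
    (φ : E →ₗ[ℝ] ℝ) (hφ : ∃ x ∈ U, ∃ y ∈ U, φ x ≠ φ y) {t : ℝ} (ht : t ∈ φ '' U) :
    openEuler (U ∩ {x | φ x = t}) = -openEuler U := by
  obtain ⟨z, hz, hzt⟩ := ht
  have hne : (U ∩ {x | φ x = t}).Nonempty := ⟨z, hz, hzt⟩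
  obtain ⟨x, hx, y, hy, hxy⟩ := hφ
  have := finrank_inf_ker_add_one (vectorSpan ℝ U) φ
    ⟨x - y, vsub_mem_vectorSpan ℝ hx hy, by simpa [sub_eq_zero] using hxy⟩
  rw [openEuler_of_nonempty hne, openEuler_of_nonempty ⟨z, hz⟩, vectorSpan_slice hU hc φ hne,
    ← this, pow_succ]
  ring

/-- The image of a relatively open convex set under a nonconstant functional is an open
interval. -/
theorem image_eq_Ioo (hU : U ⊆ relInt U) (hc : Convex ℝ U) (φ : E →ₗ[ℝ] ℝ)
    (hφ : ∃ x ∈ U, ∃ y ∈ U, φ x ≠ φ y) (hb : BddBelow (φ '' U)) (ha : BddAbove (φ '' U)) :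
    ∃ r, sInf (φ '' U) < r ∧ φ '' U = Set.Ioo (sInf (φ '' U)) r := by
  have hex : ∀ x ∈ U, (∃ y ∈ U, φ y < φ x) ∧ ∃ y ∈ U, φ x < φ y := by
    intro x hx
    have key : ∃ y ∈ U, φ y ≠ φ x := by
      obtain ⟨a, ha, b, hb, hab⟩ := hφ
      by_cases h : φ a = φ x
      · exact ⟨b, hb, fun h' => hab (h.trans h'.symm)⟩
      · exact ⟨a, ha, h⟩
    obtain ⟨y, hy, hne⟩ := key
    obtain ⟨ε, hε, h⟩ := (hU hx).2 y hy
    have hval : φ (x + ε • (x - y)) = φ x + ε * (φ x - φ y) := by simp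
    rcases lt_or_gt_of_ne hne with hlt | hgt
    · exact ⟨⟨y, hy, hlt⟩, _, h, by rw [hval]; nlinarith⟩
    · exact ⟨⟨_, h, by rw [hval]; nlinarith⟩, y, hy, hgt⟩
  obtain ⟨a, haU, -⟩ := hφ
  have hne : (φ '' U).Nonempty := ⟨_, a, haU, rfl⟩
  have heq : φ '' U = Set.Ioo (sInf (φ '' U)) (sSup (φ '' U)) := by
    apply Set.Subset.antisymm
    · rintro _ ⟨x, hx, rfl⟩
      obtain ⟨⟨y, hy, hyx⟩, z, hz, hxz⟩ := hex x hx
      exact ⟨(csInf_le hb ⟨y, hy, rfl⟩).trans_lt hyx, hxz.trans_le (le_csSup ha ⟨z, hz, rfl⟩)⟩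
    · rintro t ⟨h1, h2⟩
      obtain ⟨u, hu, hut⟩ := exists_lt_of_csInf_lt hne h1
      obtain ⟨v, hv, htv⟩ := exists_lt_of_lt_csSup hne h2
      have hconv : Convex ℝ (φ '' U) := hc.linear_image φ
      exact hconv.ordConnected.out hu hv ⟨hut.le, htv.le⟩
  refine ⟨_, ?_, heq⟩
  have : φ a ∈ Set.Ioo (sInf (φ '' U)) (sSup (φ '' U)) := heq ▸ ⟨a, haU, rfl⟩
  exact this.1.trans this.2

/-- Sweeping a hyperplane across a relatively open convex set, the Euler characteristic of the
slice jumps exactly at the infimum. -/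
theorem eventually_openEuler_slice_sub [FiniteDimensional ℝ E] (hU : U ⊆ relInt U)
    (hc : Convex ℝ U) (φ : E →ₗ[ℝ] ℝ) (hb : BddBelow (φ '' U)) (ha : BddAbove (φ '' U)) (t : ℝ) :
    ∀ᶠ s in nhdsWithin t (Set.Ioi t),
      openEuler (U ∩ {x | φ x = t}) - openEuler (U ∩ {x | φ x = s}) =
        if t = sInf (φ '' U) then openEuler U else 0 := by
  by_cases hne : U.Nonempty
  swap
  · have h0 : ∀ V : Set E, openEuler (U ∩ V) = 0 := fun V =>
      openEuler_of_not_nonempty fun h => hne h.left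
    simp [h0, openEuler_of_not_nonempty hne]
  by_cases hφ : ∃ x ∈ U, ∃ y ∈ U, φ x ≠ φ y
  · obtain ⟨r, hlr, himg⟩ := image_eq_Ioo hU hc φ hφ hb ha
    set l := sInf (φ '' U)
    -- The slice value is a step function, nonzero only on the open interval `(l, r)`. Compared with
    -- slices just to the right, it changes at `l` but not at `r`, where it is already zero.
    have hin : ∀ t, t ∈ Set.Ioo l r → openEuler (U ∩ {x | φ x = t}) = -openEuler U := fun t ht =>
      openEuler_slice hU hc φ hφ (himg ▸ ht)
    have hout : ∀ t, t ∉ Set.Ioo l r → openEuler (U ∩ {x | φ x = t}) = 0 := by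
      intro t ht
      apply openEuler_of_not_nonempty
      rintro ⟨x, hx, rfl⟩
      exact ht (himg ▸ ⟨x, hx, rfl⟩)
    rcases lt_or_ge t l with h1 | h1
    · filter_upwards [Ioo_mem_nhdsGT h1] with s hs
      rw [hout t (fun h => lt_asymm h.1 h1), hout s (fun h => lt_asymm h.1 hs.2), if_neg h1.ne,
        sub_zero]
    rcases lt_or_ge t r with h2 | h2
    · filter_upwards [Ioo_mem_nhdsGT h2] with s hs
      rw [hin s ⟨h1.trans_lt hs.1, hs.2⟩]
      rcases h1.eq_or_lt with h3 | h3
      · rw [hout t (fun h => h.1.ne h3), if_pos h3.symm]; ring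
      · rw [hin t ⟨h3, h2⟩, if_neg h3.ne']; ring
    · filter_upwards [self_mem_nhdsWithin] with s hs
      have hs' : t < s := hs
      rw [hout t (fun h => h2.not_gt h.2), hout s (fun h => (h2.trans_lt hs').not_gt h.2),
        if_neg (hlr.trans_le h2).ne', sub_zero]
  · push Not at hφ
    obtain ⟨a, haU⟩ := hne
    have hτ : ∀ x ∈ U, φ x = φ a := fun x hx => hφ x hx a haU
    have himg : φ '' U = {φ a} := by
      ext u; constructor
      · rintro ⟨x, hx, rfl⟩; exact hτ x hx
      · rintro rfl; exact ⟨a, haU, rfl⟩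
    simp only [openEuler_slice_const φ hτ, himg, csInf_singleton]
    rcases lt_or_ge t (φ a) with h1 | h1
    · filter_upwards [Ioo_mem_nhdsGT h1] with s hs
      simp [hs.2.ne]
    · filter_upwards [self_mem_nhdsWithin] with s hs
      have hs' : t < s := hs
      simp [(h1.trans_lt hs').ne']

/-- The weighted sum of slices vanishes identically, so its jump at each `t` is zero. That jump is
the weighted sum over the sets with infimum `t`; adding up over all infima gives the claim. -/
theorem sum_openEuler_eq_zero_of_slices [FiniteDimensional ℝ E] {ι : Type*} (I : Finset ι)
    (a : ι → ℤ) (V : ι → Set E) (hV : ∀ i ∈ I, V i ⊆ relInt (V i)) (hc : ∀ i ∈ I, Convex ℝ (V i))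
    (φ : E →ₗ[ℝ] ℝ) (hb : ∀ i ∈ I, BddBelow (φ '' V i)) (ha : ∀ i ∈ I, BddAbove (φ '' V i))
    (h : ∀ t, ∑ i ∈ I, a i * openEuler (V i ∩ {x | φ x = t}) = 0) :
    ∑ i ∈ I, a i * openEuler (V i) = 0 := by
  classical
  have hjump : ∀ t, ∑ i ∈ I, (if t = sInf (φ '' V i) then a i * openEuler (V i) else 0) = 0 := by
    intro t
    have hev : ∀ᶠ s in nhdsWithin t (Set.Ioi t), ∀ i ∈ I,
        openEuler (V i ∩ {x | φ x = t}) - openEuler (V i ∩ {x | φ x = s}) =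
          if t = sInf (φ '' V i) then openEuler (V i) else 0 :=
      (Filter.eventually_all_finset I).2 fun i hi =>
        eventually_openEuler_slice_sub (hV i hi) (hc i hi) φ (hb i hi) (ha i hi) t
    obtain ⟨s, hs⟩ := hev.exists
    have h2 := sub_eq_zero.2 ((h t).trans (h s).symm)
    rw [← Finset.sum_sub_distrib] at h2
    refine Eq.trans (Finset.sum_congr rfl fun i hi => ?_) h2
    rw [← mul_sub, hs i hi, mul_ite, mul_zero]
  rw [← Finset.sum_fiberwise_of_maps_to (t := I.image fun i => sInf (φ '' V i))
    (g := fun i => sInf (φ '' V i)) (fun i hi => Finset.mem_image_of_mem _ hi)]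
  refine Finset.sum_eq_zero fun t _ => ?_
  rw [Finset.sum_filter]
  exact Eq.trans (Finset.sum_congr rfl fun i _ => by simp only [eq_comm]) (hjump t)

end Euler

open Classical in
/-- A linear relation between indicator functions of bounded relatively open convex sets is
respected by the Euler characteristic. -/
theorem sum_openEuler_eq_zero {n : ℕ} {ι : Type*} (I : Finset ι) (a : ι → ℤ)
    (U : ι → Set (Fin n → ℝ)) (hU : ∀ i ∈ I, U i ⊆ relInt (U i)) (hc : ∀ i ∈ I, Convex ℝ (U i))
    (hbdd : ∀ i ∈ I, U i ⊆ Set.Icc 0 1)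
    (h : ∀ x, ∑ i ∈ I, (if x ∈ U i then a i else 0) = 0) :
    ∑ i ∈ I, a i * openEuler (U i) = 0 := by
  -- Freeze the coordinates from `k` on. At `k = 0` the slices are points and the claim is `h`; at
  -- `k = n` nothing is frozen; the inductive step sweeps along coordinate `k`.
  suffices key : ∀ k ≤ n, ∀ c : Fin n → ℝ,
      ∑ i ∈ I, a i * openEuler (U i ∩ {x | ∀ j : Fin n, k ≤ (j : ℕ) → x j = c j}) = 0 by
    have := key n le_rfl 0
    convert this using 5 with i hi
    rw [eq_comm, Set.inter_eq_left]
    intro x _ j hj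
    exact absurd j.2 (not_lt.2 hj)
  have hgood : ∀ k, ∀ c : Fin n → ℝ, ∀ i ∈ I,
      U i ∩ {x | ∀ j : Fin n, k ≤ (j : ℕ) → x j = c j} ⊆
        relInt (U i ∩ {x | ∀ j : Fin n, k ≤ (j : ℕ) → x j = c j}) ∧
      Convex ℝ (U i ∩ {x | ∀ j : Fin n, k ≤ (j : ℕ) → x j = c j}) := by
    intro k c i hi
    constructor
    · rintro x ⟨hx, hxc⟩
      refine ⟨⟨hx, hxc⟩, ?_⟩
      rintro y ⟨hy, hyc⟩
      obtain ⟨ε, hε, hz⟩ := (hU i hi hx).2 y hy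
      refine ⟨ε, hε, hz, fun j hj => ?_⟩
      simp [hxc j hj, hyc j hj]
    · refine (hc i hi).inter ?_
      intro x hx y hy s t _ _ hst j hj
      simp [hx j hj, hy j hj, ← add_mul, hst]
  intro k
  induction k with
  | zero =>
    intro _ c
    rw [← h c]
    refine Finset.sum_congr rfl fun i _ => ?_
    split_ifs with hci
    · have : U i ∩ {x | ∀ j : Fin n, 0 ≤ (j : ℕ) → x j = c j} = {c} := by
        ext x
        simp only [zero_le, forall_const, Set.mem_inter_iff, Set.mem_ofPred_eq,
          Set.mem_singleton_iff, ← funext_iff]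
        exact ⟨fun h => h.2, fun h => ⟨h ▸ hci, h⟩⟩
      rw [this, openEuler_singleton, mul_one]
    · rw [openEuler_of_not_nonempty, mul_zero]
      rintro ⟨x, hx, hxc⟩
      exact hci ((funext fun j => hxc j (Nat.zero_le _) : x = c) ▸ hx)
  | succ k ih =>
    intro hk c
    let φ : (Fin n → ℝ) →ₗ[ℝ] ℝ := LinearMap.proj ⟨k, hk⟩
    refine sum_openEuler_eq_zero_of_slices I a
      (fun i => U i ∩ {x | ∀ j : Fin n, k + 1 ≤ (j : ℕ) → x j = c j}) (fun i hi => (hgood (k + 1) c i hi).1)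
      (fun i hi => (hgood (k + 1) c i hi).2) φ ?_ ?_ fun t => ?_
    · rintro i hi
      refine ⟨0, ?_⟩
      rintro _ ⟨x, hx, rfl⟩
      exact (hbdd i hi hx.1).1 _
    · rintro i hi
      refine ⟨1, ?_⟩
      rintro _ ⟨x, hx, rfl⟩
      exact (hbdd i hi hx.1).2 _
    · rw [← ih (by omega) (Function.update c ⟨k, hk⟩ t)]
      refine Finset.sum_congr rfl fun i _ => ?_
      congr 2
      ext x
      simp only [Set.mem_inter_iff, Set.mem_ofPred_eq, and_assoc, and_congr_right_iff]
      intro _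
      constructor
      · rintro ⟨h1, h2⟩ j hj
        by_cases hjk : j = ⟨k, hk⟩
        · subst hjk; simpa [φ] using h2
        · rw [Function.update_of_ne hjk]
          exact h1 j (by have : (j : ℕ) ≠ k := fun h => hjk (Fin.ext h)
                         omega)
      · intro h1
        refine ⟨fun j hj => ?_, ?_⟩
        · have hjk : j ≠ ⟨k, hk⟩ := by rintro rfl; simp at hj
          rw [h1 j (by omega), Function.update_of_ne hjk]
        · simpa [φ] using h1 ⟨k, hk⟩ le_rfl

/-! ### Matroid polytopes and rank functionals -/

namespace Mat

variable {n : ℕ} (M N : Mat n)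

theorem convex_polytope : Convex ℝ M.polytope := convex_convexHull ℝ _

theorem polytope_nonempty : M.polytope.Nonempty := by
  obtain ⟨B, hB⟩ := M.1.exists_isBase
  exact ⟨_, subset_convexHull ℝ _ ⟨B, hB, rfl⟩⟩

theorem polytope_subset_Icc : M.polytope ⊆ Set.Icc 0 1 := by
  refine convexHull_min ?_ (convex_Icc 0 1)
  rintro _ ⟨B, -, rfl⟩
  exact ⟨fun i => Set.indicator_nonneg (fun _ _ => zero_le_one) i,
    fun i => Set.indicator_le_self' (fun _ _ => zero_le_one) i⟩

theorem eRk_ne_top (S : Set (Fin n)) : M.1.eRk S ≠ ⊤ :=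
  ((M.1.eRk_le_encard S).trans_lt S.toFinite.encard_lt_top).ne

theorem rk_le_card (S : Finset (Fin n)) : M.rk S ≤ S.card := by
  have := ENat.toNat_le_toNat (M.1.eRk_le_encard (S : Set (Fin n)))
    S.finite_toSet.encard_lt_top.ne
  simpa [Mat.rk] using this

theorem ncard_le_rk {I : Set (Fin n)} (hI : M.1.Indep I) {S : Finset (Fin n)}
    (h : I ⊆ (S : Set (Fin n))) : I.ncard ≤ M.rk S :=
  ENat.toNat_le_toNat (hI.encard_le_eRk_of_subset h) (M.eRk_ne_top _)

/-- Extend a basis of `S` to a basis of `T`, then to a base: nestedness lets one base be optimal for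
both sets. -/
theorem exists_isBase_rk {S T : Finset (Fin n)} (hST : S ⊆ T) :
    ∃ B, M.1.IsBase B ∧ M.rk S ≤ (B ∩ S).ncard ∧ M.rk T ≤ (B ∩ T).ncard := by
  have hE : ∀ X : Set (Fin n), X ⊆ M.1.E := fun X =>
    (Set.subset_univ X).trans_eq M.2.symm
  obtain ⟨I, hI⟩ := M.1.exists_isBasis (S : Set (Fin n)) (hE _)
  obtain ⟨J, hJ, hIJ⟩ := hI.indep.subset_isBasis_of_subset
    (hI.subset.trans (Finset.coe_subset.2 hST)) (hE _)
  obtain ⟨B, hB, hJB⟩ := hJ.indep.exists_isBase_superset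
  refine ⟨B, hB, ?_, ?_⟩
  · rw [Mat.rk, ← hI.encard_eq_eRk, ← Set.ncard_def]
    exact Set.ncard_le_ncard (Set.subset_inter (hIJ.trans hJB) hI.subset) (Set.toFinite _)
  · rw [Mat.rk, ← hJ.encard_eq_eRk, ← Set.ncard_def]
    exact Set.ncard_le_ncard (Set.subset_inter hJB hJ.subset) (Set.toFinite _)

theorem sum_indicator_eq_ncard (B : Set (Fin n)) (S : Finset (Fin n)) :
    ∑ i ∈ S, B.indicator (fun _ => (1 : ℝ)) i = ((B ∩ S).ncard : ℝ) := by
  classical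
  simp only [Set.indicator_apply]
  rw [Finset.sum_boole, ← Set.ncard_coe_finset]
  congr 2
  ext i
  simp [and_comm]

/-- A linear functional whose maximum over a matroid polytope encodes the ranks of both `S` and
`T` when `S ⊆ T`. -/
noncomputable def flagWeight (S T : Finset (Fin n)) : (Fin n → ℝ) →ₗ[ℝ] ℝ :=
  ((n : ℝ) + 1) • ∑ i ∈ S, LinearMap.proj i + ∑ i ∈ T, LinearMap.proj i

theorem flagWeight_indicator (S T : Finset (Fin n)) (B : Set (Fin n)) :
    flagWeight S T (B.indicator fun _ => (1 : ℝ)) =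
      (((n + 1) * (B ∩ S).ncard + (B ∩ T).ncard : ℕ) : ℝ) := by
  simp [flagWeight, sum_indicator_eq_ncard]

/-- The ranks of `S` and `T`, encoded in one natural number. -/
noncomputable def flagRank (S T : Finset (Fin n)) : ℕ := (n + 1) * M.rk S + M.rk T

/-- The flag rank is the maximum of the functional: it bounds the value at every vertex, and the
base from `exists_isBase_rk` attains it. -/
theorem polytope_inter_flagWeight_nonempty {S T : Finset (Fin n)} (hST : S ⊆ T) (c : ℝ) :
    (M.polytope ∩ {x | c < flagWeight S T x}).Nonempty ↔ c < (M.flagRank S T : ℝ) := by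
  constructor
  · rintro ⟨x, hx, hxc⟩
    refine lt_of_lt_of_le hxc ?_
    have : M.polytope ⊆ {x | flagWeight S T x ≤ (M.flagRank S T : ℝ)} := by
      refine convexHull_min ?_ (convex_halfSpace_le (flagWeight S T).isLinear _)
      rintro _ ⟨B, hB, rfl⟩
      have hle : ∀ S : Finset (Fin n), (B ∩ S).ncard ≤ M.rk S := fun S =>
        M.ncard_le_rk (hB.indep.subset Set.inter_subset_left) Set.inter_subset_right
      rw [Set.mem_ofPred_eq, flagWeight_indicator, Nat.cast_le]
      exact Nat.add_le_add (Nat.mul_le_mul_left _ (hle S)) (hle T)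
    exact this hx
  · intro h
    obtain ⟨B, hB, h1, h2⟩ := M.exists_isBase_rk hST
    refine ⟨_, subset_convexHull ℝ _ ⟨B, hB, rfl⟩, h.trans_le ?_⟩
    rw [flagWeight_indicator, Nat.cast_le]
    exact Nat.add_le_add (Nat.mul_le_mul_left _ h1) h2

variable {M N}

/-- Taking `T = S`, the maximum of the functional is `(n + 2) * rk S`, so the polytope determines
all ranks and hence the independent sets. -/
theorem polytope_injective : Function.Injective (Mat.polytope (n := n)) := by
  intro M N h
  have hrk : ∀ S, M.rk S = N.rk S := by
    intro S
    have hw : M.flagRank S S = N.flagRank S S := by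
      have hiff : ∀ c : ℝ, c < (M.flagRank S S : ℝ) ↔ c < (N.flagRank S S : ℝ) := fun c => by
        rw [← polytope_inter_flagWeight_nonempty _ subset_rfl, h,
          polytope_inter_flagWeight_nonempty _ subset_rfl]
      exact_mod_cast eq_of_forall_lt_iff hiff
    have : (n + 2) * M.rk S = (n + 2) * N.rk S := by
      simp only [flagRank] at hw; linarith
    exact Nat.eq_of_mul_eq_mul_left (by omega) this
  refine Subtype.ext (Matroid.ext_indep (M.2.trans N.2.symm) fun I _ => ?_)
  rw [Matroid.indep_iff_eRk_eq_encard_of_finite I.toFinite,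
    Matroid.indep_iff_eRk_eq_encard_of_finite I.toFinite]
  lift I to Finset (Fin n) using I.toFinite
  have := hrk I
  rw [← ENat.natCast_toNat (M.eRk_ne_top I), ← ENat.natCast_toNat (N.eRk_ne_top I)]
  simp only [Mat.rk] at this
  rw [this]

theorem sum_eq_rk_univ {x : Fin n → ℝ} (hx : x ∈ M.polytope) :
    ∑ i, x i = (M.rk Finset.univ : ℝ) := by
  have : M.polytope ⊆
      {x | (∑ i, LinearMap.proj i : (Fin n → ℝ) →ₗ[ℝ] ℝ) x = (M.rk Finset.univ : ℝ)} := by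
    refine convexHull_min ?_ (convex_hyperplane (LinearMap.isLinear _) _)
    rintro _ ⟨B, hB, rfl⟩
    have h1 := sum_indicator_eq_ncard B Finset.univ
    have h2 : B.ncard = M.rk Finset.univ := by
      rw [Mat.rk, Set.ncard_def, hB.encard_eq_eRank, Matroid.eRank_def, M.2, Finset.coe_univ]
    simpa [h2] using h1
  simpa using this hx

theorem rk_univ_eq_of_polytope_subset (h : N.polytope ⊆ M.polytope) :
    N.rk Finset.univ = M.rk Finset.univ := by
  obtain ⟨x, hx⟩ := N.polytope_nonempty
  have := (sum_eq_rk_univ hx).symm.trans (sum_eq_rk_univ (h hx))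
  exact_mod_cast this

theorem rk_relabel (M : Mat n) (σ : Equiv.Perm (Fin n)) (S : Finset (Fin n)) :
    (M.relabel σ).rk (S.map σ.toEmbedding) = M.rk S := by
  have hE : (S : Set (Fin n)) ⊆ M.1.E := (Set.subset_univ _).trans_eq M.2.symm
  simp only [Mat.rk, Mat.relabel, Matroid.mapEquiv_eq_map, Finset.coe_map, Equiv.coe_toEmbedding]
  rw [Matroid.eRk_map _ _ hE]

theorem tutteLike_relabel (M : Mat n) (σ : Equiv.Perm (Fin n)) :
    (M.relabel σ).tutteLike = M.tutteLike := by
  have hu : (M.relabel σ).rk Finset.univ = M.rk Finset.univ := by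
    rw [← rk_relabel M σ, Finset.map_univ_equiv]
  simp only [Mat.tutteLike, hu]
  symm
  refine Fintype.sum_equiv σ.finsetCongr _ _ fun T => ?_
  refine Finset.sum_equiv σ.finsetCongr (fun S => ?_) fun S _ => ?_
  · simp [Equiv.finsetCongr_apply]
  · simp [Equiv.finsetCongr_apply, rk_relabel]

end Mat

/-- Subtracting the relations for `c` and `c + 1` turns thresholds into level sets; weighting level
`c` by `G c` and summing gives the identity. -/
theorem sum_smul_comp_eq_of_sum_threshold {ι A : Type*} [AddCommGroup A] (I : Finset ι)
    (ε : ι → ℤ) (h : ι → ℕ) (h₀ : ℕ)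
    (H : ∀ c : ℕ, ∑ i ∈ I, (if c ≤ h i then ε i else 0) = if c ≤ h₀ then 1 else 0) (G : ℕ → A) :
    G h₀ = ∑ i ∈ I, ε i • G (h i) := by
  have Heq : ∀ c : ℕ, ∑ i ∈ I, (if c = h i then ε i else 0) = if c = h₀ then 1 else 0 := by
    intro c
    have key : ∀ (m : ℕ) (e : ℤ), (if c = m then e else 0) =
        (if c ≤ m then e else 0) - if c + 1 ≤ m then e else 0 := by
      intro m e
      split_ifs <;> omega
    simp only [key, Finset.sum_sub_distrib, H]
  set C : Finset ℕ := insert h₀ (I.image h)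
  have h1 : ∀ i ∈ I, ε i • G (h i) = ∑ c ∈ C, (if c = h i then ε i else 0) • G c := by
    intro i hi
    have : h i ∈ C := Finset.mem_insert_of_mem (Finset.mem_image_of_mem _ hi)
    simp [ite_smul, this]
  rw [Finset.sum_congr rfl h1, Finset.sum_comm]
  simp only [← Finset.sum_smul, Heq]
  simp [ite_smul, C]

/-! ### Cells of a subdivision and valuative half-space conditions -/

namespace IsMatroidalSubdivision

variable {n : ℕ} {M : Mat n} {D : Set (Set (Fin n → ℝ))}

theorem subset_polytope (hD : IsMatroidalSubdivision M D) {F : Set (Fin n → ℝ)} (hF : F ∈ D) :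
    F ⊆ M.polytope := hD.union_eq ▸ Set.subset_sUnion_of_mem hF

theorem finite (hD : IsMatroidalSubdivision M D) : D.Finite :=
  (Set.finite_range (Mat.polytope (n := n))).subset fun P hP => hD.matroidal P hP

/-- Every point of the polytope is in the relative interior of some cell. -/
theorem exists_mem_relInt (hD : IsMatroidalSubdivision M D) {x : Fin n → ℝ}
    (hx : x ∈ M.polytope) : ∃ F ∈ D, x ∈ relInt F := by
  have hx' := hx
  rw [← hD.union_eq] at hx'
  obtain ⟨F₀, hF₀, hxF₀⟩ := hx'
  -- In a minimal cell containing `x`, the point lies on no proper face, as that face would be a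
  -- smaller cell.
  obtain ⟨F, hF⟩ := (hD.finite.subset (Set.sep_subset D fun F => x ∈ F)).exists_minimal
    ⟨F₀, hF₀, hxF₀⟩
  refine ⟨F, hF.prop.1, ?_⟩
  by_contra hxF
  obtain ⟨N, rfl⟩ := hD.matroidal F hF.prop.1
  obtain ⟨G, hG, hxG, hne, -⟩ :=
    exists_proper_face_of_notMem_relInt N.convex_polytope hF.prop.2 hxF
  exact hne (hF.eq_of_subset ⟨hD.face_mem _ hF.prop.1 G hG, hxG⟩ hG.2.subset)

/-- The relative interiors of the cells are disjoint. -/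
theorem eq_of_mem_relInt (hD : IsMatroidalSubdivision M D) {F G : Set (Fin n → ℝ)} (hF : F ∈ D)
    (hG : G ∈ D) {x : Fin n → ℝ} (hxF : x ∈ relInt F) (hxG : x ∈ relInt G) : F = G := by
  have hx : x ∈ F ∩ G := ⟨hxF.1, hxG.1⟩
  obtain ⟨h1, h2⟩ := hD.inter_face F hF G hG ⟨x, hx⟩
  exact (h1.eq_of_mem_relInt hx hxF).symm.trans (h2.eq_of_mem_relInt hx hxG)

theorem mem_internalCells_iff (hD : IsMatroidalSubdivision M D) {F : Set (Fin n → ℝ)}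
    (hF : F ∈ D) {x : Fin n → ℝ} (hxF : x ∈ relInt F) :
    F ∈ internalCells M.polytope D ↔ x ∈ relInt M.polytope := by
  constructor
  · rintro ⟨-, h⟩
    by_contra hx
    obtain ⟨G, hG, -, hne, hsub⟩ := exists_proper_face_of_notMem_relInt M.convex_polytope
      (hD.subset_polytope hF hxF.1) hx
    exact hne (h G hG (hsub F (hD.subset_polytope hF) hxF))
  · exact fun hx => ⟨hF, fun G hG hFG => hG.eq_of_mem_relInt (hFG hxF.1) hx⟩

open Classical in
/-- The relative interior of `P(M)` is the disjoint union of those of the internal cells. -/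
theorem sum_indicator_relInt (hD : IsMatroidalSubdivision M D) (x : Fin n → ℝ) :
    (∑ N : Mat n with N.polytope ∈ internalCells M.polytope D,
      if x ∈ relInt N.polytope then (1 : ℤ) else 0) = if x ∈ relInt M.polytope then 1 else 0 := by
  split_ifs with hx
  · obtain ⟨F, hF, hxF⟩ := hD.exists_mem_relInt hx.1
    obtain ⟨N, rfl⟩ := hD.matroidal F hF
    have hN := (hD.mem_internalCells_iff hF hxF).2 hx
    rw [Finset.sum_eq_single_of_mem N (by simpa using hN), if_pos hxF]
    intro N' hN' hne
    rw [if_neg]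
    intro hx'
    rw [Finset.mem_filter_univ] at hN'
    exact hne (Mat.polytope_injective (hD.eq_of_mem_relInt hN'.1 hF hx' hxF))
  · refine Finset.sum_eq_zero fun N hN => if_neg fun hxN => hx ?_
    rw [Finset.mem_filter_univ] at hN
    exact (hD.mem_internalCells_iff hN.1 hxN).1 hN

end IsMatroidalSubdivision

open Classical in
theorem Mat.openEuler_relInt_inter_halfspace {n : ℕ} (N : Mat n) (φ : (Fin n → ℝ) →ₗ[ℝ] ℝ)
    (c : ℝ) : openEuler (relInt N.polytope ∩ {x | c < φ x}) =
      if (N.polytope ∩ {x | c < φ x}).Nonempty then (-1) ^ polytopeDim N.polytope else 0 := by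
  split_ifs with h
  · have h' := relInt_inter_halfspace_nonempty N.convex_polytope
      (relInt_nonempty N.convex_polytope N.polytope_nonempty) φ c h
    rw [openEuler_of_nonempty h', vectorSpan_relInt_inter_halfspace N.convex_polytope φ c h',
      polytopeDim]
  · exact openEuler_of_not_nonempty fun h' =>
      h (h'.mono (Set.inter_subset_inter_left _ (relInt_subset _)))

namespace IsMatroidalSubdivision

variable {n : ℕ} {M : Mat n} {D : Set (Set (Fin n → ℝ))}

open Classical in
/-- Meeting a fixed open half-space is a valuative property. -/
theorem sum_meets_halfspace (hD : IsMatroidalSubdivision M D) (φ : (Fin n → ℝ) →ₗ[ℝ] ℝ) (c : ℝ) :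
    (∑ N : Mat n with N.polytope ∈ internalCells M.polytope D,
      if (N.polytope ∩ {x | c < φ x}).Nonempty then
        (-1 : ℤ) ^ (polytopeDim M.polytope - polytopeDim N.polytope) else 0) =
      if (M.polytope ∩ {x | c < φ x}).Nonempty then 1 else 0 := by
  set I := Finset.univ.filter fun N : Mat n => N.polytope ∈ internalCells M.polytope D with hI
  -- The index `none` stands for `P(M)` itself with coefficient `-1`, kept apart from a possible
  -- cell equal to `P(M)`.
  let p : Option (Mat n) → Mat n := fun o => o.getD M
  have key := sum_openEuler_eq_zero (Finset.insertNone I) (fun o => o.elim (-1) fun _ => 1)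
    (fun o => relInt (p o).polytope ∩ {x | c < φ x})
    (fun o _ => halfspace_subset_relInt (subset_relInt_relInt (p o).convex_polytope)
      (convex_relInt (p o).convex_polytope) φ c)
    (fun o _ => (convex_relInt (p o).convex_polytope).inter (convex_halfSpace_gt φ.isLinear c))
    (fun o _ => Set.inter_subset_left.trans
      ((relInt_subset _).trans (p o).polytope_subset_Icc))
    (fun x => by
      rw [Finset.sum_insertNone]
      have := hD.sum_indicator_relInt x
      rw [← hI] at this
      by_cases hx : c < φ x
      · simp only [p, Option.elim_none, Option.elim_some, Option.getD_none, Option.getD_some,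
          Set.mem_inter_iff, Set.mem_ofPred_eq, hx, and_true]
        rw [this]
        split_ifs <;> simp
      · simp [hx])
  rw [Finset.sum_insertNone] at key
  simp only [p, Option.elim_none, Option.elim_some, Option.getD_none, Option.getD_some,
    Mat.openEuler_relInt_inter_halfspace, one_mul] at key
  have hsum : ∑ N ∈ I, (if (N.polytope ∩ {x | c < φ x}).Nonempty then
      (-1 : ℤ) ^ polytopeDim N.polytope else 0) =
      if (M.polytope ∩ {x | c < φ x}).Nonempty then (-1) ^ polytopeDim M.polytope else 0 := by
    linarith
  -- Normalises the right side to `1`; on the left, the sum and the difference of the dimensions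
  -- have the same parity.
  have hmul := congrArg (fun z => (-1 : ℤ) ^ polytopeDim M.polytope * z) hsum
  simp only [Finset.mul_sum, mul_ite, mul_zero, ← pow_add, ← two_mul, pow_mul] at hmul
  norm_num at hmul
  rw [← hmul]
  refine Finset.sum_congr rfl fun N hN => ?_
  rw [hI, Finset.mem_filter_univ] at hN
  have hdim : polytopeDim N.polytope ≤ polytopeDim M.polytope :=
    Submodule.finrank_mono (vectorSpan_mono ℝ (hD.subset_polytope hN.1))
  congr 1
  obtain ⟨d, hd⟩ := Nat.exists_eq_add_of_le hdim
  rw [hd, Nat.add_sub_cancel_left, add_right_comm, pow_add, ← two_mul, pow_mul]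
  simp

open Classical in
theorem sum_flagRank (hD : IsMatroidalSubdivision M D) {A : Type*} [AddCommGroup A]
    {S T : Finset (Fin n)} (hST : S ⊆ T) (G : ℕ → A) :
    G (M.flagRank S T) = ∑ N : Mat n with N.polytope ∈ internalCells M.polytope D,
      (-1 : ℤ) ^ (polytopeDim M.polytope - polytopeDim N.polytope) • G (N.flagRank S T) := by
  refine sum_smul_comp_eq_of_sum_threshold _ _ (fun N : Mat n => N.flagRank S T) _ (fun c => ?_) G
  -- The half-space is open, so the integral threshold `c ≤ m` is written `c - 1 < m`.
  have := hD.sum_meets_halfspace (Mat.flagWeight S T) ((c : ℝ) - 1)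
  have hc : ∀ m : ℕ, (c : ℝ) - 1 < m ↔ c ≤ m := fun m => by
    rw [sub_lt_iff_lt_add, ← Nat.lt_succ_iff]
    exact_mod_cast Iff.rfl
  simpa only [Mat.polytope_inter_flagWeight_nonempty _ hST, hc] using this

end IsMatroidalSubdivision

/-! ### Decoding the ranks and conclusion -/

theorem Mat.flagRank_div_mod {n : ℕ} (M : Mat n) (S T : Finset (Fin n)) :
    M.flagRank S T / (n + 1) = M.rk S ∧ M.flagRank S T % (n + 1) = M.rk T := by
  have hT : M.rk T < n + 1 :=
    Nat.lt_succ_of_le ((M.rk_le_card T).trans (by simpa using T.card_le_univ))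
  rw [Mat.flagRank, Nat.mul_add_div (Nat.succ_pos n), Nat.div_eq_of_lt hT, Nat.mul_add_mod,
    Nat.mod_eq_of_lt hT]
  exact ⟨rfl, rfl⟩

theorem isValuative_tutteLike (n : ℕ) : IsValuative fun M : Mat n => M.tutteLike := by
  classical
  intro M D hD
  simp only [Mat.tutteLike, Finset.smul_sum]
  rw [Finset.sum_comm]
  refine Finset.sum_congr rfl fun T _ => ?_
  rw [Finset.sum_comm]
  refine Finset.sum_congr rfl fun S hS => ?_
  -- `G` reads the two ranks off as quotient and remainder modulo `n + 1`. It uses the total rank of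
  -- `M` for every cell, which is correct because the coordinate sum is constant on `P(M)`.
  have key := hD.sum_flagRank (Finset.mem_powerset.1 hS) fun h =>
    (MvPolynomial.X 0 ^ (S.card - h / (n + 1)) *
      MvPolynomial.X 1 ^ (M.rk Finset.univ - h % (n + 1)) *
      MvPolynomial.X 2 ^ (T.card - S.card) : MvPolynomial (Fin 3) ℤ)
  simp only [(Mat.flagRank_div_mod _ S T).1, (Mat.flagRank_div_mod _ S T).2] at key
  rw [key]
  refine Finset.sum_congr rfl fun N hN => ?_
  have hN := (Finset.mem_filter.1 hN).2
  rw [Mat.rk_univ_eq_of_polytope_subset (hD.subset_polytope hN.1)]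

theorem mainTheorem4 (n : ℕ) :
    IsValuative (fun M : Mat n => M.tutteLike) ∧
      IsMatroidInvariant (fun M : Mat n => M.tutteLike) :=
  ⟨isValuative_tutteLike n, Mat.tutteLike_relabel⟩
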